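/- **Setting.** Alice and Bob share a two-qubit density operator $\rho$ on $A\otimes B$. In the particle/no-particle (PNP) game Charlie prepares, with probability $\tfrac12$ each, two qubits $A_pB_p$ in the state $|\mathrm{p}\rangle=\frac1{\sqrt2}(|01\rangle+|10\rangle)$ or $|\mathrm{np}\rangle=|00\rangle$. Alice and Bob apply, for unitaries $U$ on $A$ and $V$ on $B$, the interaction $$W=\mathbb 1\otimes|00\rangle\langle00|+U_A\otimes|10\rangle\langle10|+V_B\otimes|01\rangle\langle01|+(U\otimes V)\otimes|11\rangle\langle11|,$$ where $U_A=U\otimes\mathbb 1$, $V_B=\mathbb 1\otimes V$, and the projectors act on $A_pB_p$. They return $A_pB_p$ to Charlie, who projects it onto the state $|z\rangle$ that he sent, and they measure a two-outcome POVM $(\Pi^{(\mathrm p)},\Pi^{(\mathrm{np})})$ on $AB$. Their win probability is $$p=\sum_{z\in\{\mathrm p,\mathrm{np}\}}\tfrac12\,\mathrm{Tr}\big[(\Pi^{(z)}\otimes|z\rangle\langle z|)\,W(\rho\otimes|z\rangle\langle z|)W^\dagger\big].$$ Call $(U,V)$ *admissible* for $\rho$ if Charlie's state is never disturbed: $\mathrm{Tr}\big[(\mathbb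 1\otimes|z\rangle\langle z|)W(\rho\otimes|z\rangle\langle z|)W^\dagger\big]=1$ for both $z$. Let $p^{\mathrm m}_{\mathrm{pnp2}}(\rho)$ be the maximum of $p$ over all admissible $(U,V)$ and all POVMs. Call $\rho$ * *usable* if it has an admissible pair $(U,V)$ in which neither $U$ nor $V$ is a multiple of the identity; * *strongly anonymous* if $U_A\rho=V_B\rho$ for some unitaries $U,V$, neither of which is a multiple of the identity; * *maximally correlated* if there are orthonormal bases of $A$ and $B$ such that, in the product basis, $$\rho=r|00\rangle\langle00|+c|00\rangle\langle11|+c^*|11\rangle\langle00|+(1-r)|11\rangle\langle11|,\qquad r\in\mathbb R,\ c\in\mathbb C.\tag{1}$$ Let $T(\rho,\sigma)=\frac12\mathrm{Tr}\sqrt{(\rho-\sigma)^\dagger(\rho-\sigma)}$, and let $C(\rho)=\max\{0,\sqrt{\lambda_1}-\sqrt{\lambda_2}-\sqrt{\lambda_3}-\sqrt{\lambda_4}\}$ be the Wootters concurrence, where $\lambda_1\ge\dots\ge\lambda_4$ are the eigenvalues (with algebraic multiplicity) of $\rho\,(Y\otimes Y)\rho^*(Y\otimes Y)$, $Y$ is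 the Pauli matrix, and $\rho^*$ is the entrywise conjugate of $\rho$ in the computational basis. **Theorem.** For every two-qubit density operator $\rho$: 1. For unitaries $U,V$: $(U,V)$ is admissible $\iff\mathrm{Re}\,\mathrm{Tr}(U_A\rho V_B^\dagger)=1\iff U_A\rho=V_B\rho$. 2. For admissible $(U,V)$, the maximum of $p$ over all POVMs exists and equals $\frac12\big[1+T(U_A\rho U_A^\dagger,\rho)\big]$. 3. $\rho$ is usable $\iff$ $\rho$ is strongly anonymous $\iff$ $\rho$ is maximally correlated. Moreover, for every admissible $(U,V)$ in which neither $U$ nor $V$ is a multiple of the identity, $\rho$ has the form (1) in some orthonormal eigenbases of $U$ and $V$. 4. Whenever $\rho$ has the form (1), the maximum of $T(U_A\rho U_A^\dagger,\rho)$ over all admissible $(U,V)$ exists, and it equals $2|c|=C(\rho)$. 5. If $\rho$ is strongly anonymous, then $p^{\mathrm m}_{\mathrm{pnp2}}(\rho)=\frac12\,[1+C(\rho)]$ (the maximum is attained). If $\rho$ is not strongly anonymous, then $p^{\mathrm m}_{\mathrm{pnp2}}(\rho)=\frac12$ (attained). -/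

import Mathlib

open scoped Kronecker ComplexConjugate ComplexOrder

noncomputable section

namespace DelocalisedGame

/-- Index set of the computational basis of two qubits. -/
abbrev Two : Type := Fin 2 × Fin 2

/-- Operators on one qubit. -/
abbrev Op1 : Type := Matrix (Fin 2) (Fin 2) ℂ

/-- Operators on two qubits. -/
abbrev Op2 : Type := Matrix Two Two ℂ

/-- Operators on `(A ⊗ B) ⊗ (A_p ⊗ B_p)`. -/
abbrev Op4 : Type := Matrix (Two × Two) (Two × Two) ℂ

/-- Density operators of two qubits. -/
def IsDensity (ρ : Op2) : Prop := ρ.PosSemidef ∧ ρ.trace = 1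

/-- The basis vector `|ij⟩`. -/
def ket (i j : Fin 2) : Two → ℂ := Pi.single (i, j) 1

/-- The rank-one operator `|ψ⟩⟨ψ|`. -/
def ketbra (ψ : Two → ℂ) : Op2 := Matrix.vecMulVec ψ (star ψ)

/-- `U` acting on the first qubit (of A). -/
def onA (U : Op1) : Op2 := U ⊗ₖ (1 : Op1)

/-- `V` acting on the second qubit (of B). -/
def onB (V : Op1) : Op2 := (1 : Op1) ⊗ₖ V

/-- The overall local controlled interaction of A and B with the particle modes:
`U` acts on A iff `A_p` is occupied and `V` acts on B iff `B_p` is occupied. -/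
def interaction (U V : Op1) : Op4 :=
  (1 : Op2) ⊗ₖ ketbra (ket 0 0) + onA U ⊗ₖ ketbra (ket 1 0) +
    onB V ⊗ₖ ketbra (ket 0 1) + (U ⊗ₖ V) ⊗ₖ ketbra (ket 1 1)

/-- A measurement (POVM) on the two-qubit system `AB` with outcomes in `Z`. -/
def IsPOVM {Z : Type} [Fintype Z] (M : Z → Op2) : Prop :=
  (∀ z, (M z).PosSemidef) ∧ ∑ z, M z = 1

/-- Win probability `∑ z, P z * Tr[(M z ⊗ |z⟩⟨z|) W (ρ ⊗ |z⟩⟨z|) W†]` of the game with question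
states `q z`, sent with probabilities `P z`. -/
def winProb {Z : Type} [Fintype Z] (P : Z → ℝ) (q : Z → Two → ℂ) (W : Op4) (ρ : Op2)
    (M : Z → Op2) : ℝ :=
  ∑ z, P z * ((M z ⊗ₖ ketbra (q z)) * (W * (ρ ⊗ₖ ketbra (q z)) * W.conjTranspose)).trace.re

/-- Probability that C, having sent the state `ψ`, projects the returned modes onto `ψ`. -/
def returnProb (ψ : Two → ℂ) (W : Op4) (ρ : Op2) : ℝ :=
  (((1 : Op2) ⊗ₖ ketbra ψ) * (W * (ρ ⊗ₖ ketbra ψ) * W.conjTranspose)).trace.re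

/-- Question states of the particle/no-particle game: `true` is the particle state
`(|01⟩ + |10⟩)/√2`, `false` is the no-particle state `|00⟩`. -/
def pnpState : Bool → Two → ℂ
  | true => ((1 / √2 : ℝ) : ℂ) • (ket 0 1 + ket 1 0)
  | false => ket 0 0

/-- Win probability of the particle/no-particle game (both questions equally likely). -/
def pnpWinProb (ρ : Op2) (U V : Op1) (M : Bool → Op2) : ℝ :=
  winProb (fun _ => 1 / 2) pnpState (interaction U V) ρ M

/-- The interaction never disturbs C's state: C always projects onto the state he sent. -/
def NeverDisturbs (ρ : Op2) (U V : Op1) : Prop :=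
  ∀ z, returnProb (pnpState z) (interaction U V) ρ = 1

/-- Local unitaries `U`, `V` that are allowed when C's state must never be disturbed. -/
def Admissible (ρ : Op2) (U V : Op1) : Prop :=
  U ∈ Matrix.unitaryGroup (Fin 2) ℂ ∧ V ∈ Matrix.unitaryGroup (Fin 2) ℂ ∧ NeverDisturbs ρ U V

/-- All win probabilities that A and B can reach with the state `ρ` when they must never disturb
C's state. -/
def pnp2WinProbs (ρ : Op2) : Set ℝ :=
  {p | ∃ U V M, Admissible ρ U V ∧ IsPOVM M ∧ p = pnpWinProb ρ U V M}

/-- `U` is not a multiple of the identity. -/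
def NonScalar (U : Op1) : Prop := ∀ z : ℂ, U ≠ z • (1 : Op1)

/-- `ρ` can be used non-trivially when C's state must never be disturbed. -/
def Usable (ρ : Op2) : Prop :=
  ∃ U V, Admissible ρ U V ∧ NonScalar U ∧ NonScalar V

/-- Strongly anonymous states: `U_A ρ = V_B ρ` for some non-trivial local unitaries. -/
def StronglyAnonymous (ρ : Op2) : Prop :=
  ∃ U ∈ Matrix.unitaryGroup (Fin 2) ℂ, ∃ V ∈ Matrix.unitaryGroup (Fin 2) ℂ,
    NonScalar U ∧ NonScalar V ∧ onA U * ρ = onB V * ρ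

/-- `r |00⟩⟨00| + c |00⟩⟨11| + c* |11⟩⟨00| + (1 - r) |11⟩⟨11|` in the computational basis. -/
def mcMatrix (r : ℝ) (c : ℂ) : Op2 :=
  (r : ℂ) • Matrix.single (0, 0) (0, 0) 1 + c • Matrix.single (0, 0) (1, 1) 1 +
    conj c • Matrix.single (1, 1) (0, 0) 1 + ((1 - r : ℝ) : ℂ) • Matrix.single (1, 1) (1, 1) 1

/-- `ρ` has the form `mcMatrix r c` in the product of the two local orthonormal bases formed by
the columns of the unitaries `S` and `T`. -/
def HasMCForm (ρ : Op2) (S T : Op1) (r : ℝ) (c : ℂ) : Prop :=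
  S ∈ Matrix.unitaryGroup (Fin 2) ℂ ∧ T ∈ Matrix.unitaryGroup (Fin 2) ℂ ∧
    ρ = (S ⊗ₖ T) * mcMatrix r c * (S ⊗ₖ T).conjTranspose

/-- Maximally correlated two-qubit states. -/
def MaximallyCorrelated (ρ : Op2) : Prop := ∃ S T r c, HasMCForm ρ S T r c

/-- Trace distance `(1/2) Tr √((ρ - σ)† (ρ - σ))`. -/
def traceDist (ρ σ : Op2) : ℝ :=
  1 / 2 * (cfc Real.sqrt ((ρ - σ).conjTranspose * (ρ - σ))).trace.re

/-- The state after the action of `U` on A. -/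
def conjA (U : Op1) (ρ : Op2) : Op2 := onA U * ρ * (onA U).conjTranspose

/-- The Pauli matrix `Y`. -/
def pauliY : Op1 := !![0, -Complex.I; Complex.I, 0]

/-- The spin-flipped state `(Y ⊗ Y) ρ* (Y ⊗ Y)`, where `ρ*` is the entrywise conjugate. -/
def spinFlip (ρ : Op2) : Op2 := (pauliY ⊗ₖ pauliY) * ρ.map conj * (pauliY ⊗ₖ pauliY)

/-- The square roots of the eigenvalues of `ρ ρ̃` (with algebraic multiplicity) in decreasing
order. For a density operator these eigenvalues are real and nonnegative. -/
def woottersSpectrum (ρ : Op2) : List ℝ :=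
  ((ρ * spinFlip ρ).charpoly.roots.map fun z => √z.re).sort (· ≥ ·)

/-- The Wootters concurrence `max {0, √λ₁ - √λ₂ - √λ₃ - √λ₄}`. -/
def concurrence (ρ : Op2) : ℝ :=
  let l := woottersSpectrum ρ
  max 0 (l.getD 0 0 - l.getD 1 0 - l.getD 2 0 - l.getD 3 0)

end DelocalisedGame

end

/-! Projecting the returned modes onto the particle state replaces the interaction by the single
operator $K=\frac12(U_A+V_B)$, while the no-particle state is always returned and leaves $\rho$
unchanged. The return probability $\mathrm{Tr}\,K\rho
K^\dagger=\frac12(1+\mathrm{Re}\,\mathrm{Tr}\,U_A\rho V_B^\dagger)$ equals $1$ exactly when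
$D=U_A-V_B$ satisfies $\mathrm{Tr}\,D\rho D^\dagger=0$, that is $D\rho=0$
(`neverDisturbs_iff_mul_eq`). Then $K\rho=U_A\rho$, so the game is to discriminate $U_A\rho
U_A^\dagger$ from $\rho$, and Helstrom's bound `isGreatest_trace_effect` gives the best measurement.

In eigenbases of $U$ and $V$ the condition reads $(d_i-e_j)\rho_{ij,x}=0$. If neither unitary is
scalar, then after possibly swapping the basis of $B$ only the rows $00$ and $11$ survive, which is
the maximally correlated form (`exists_hasMCForm`). Conversely, sign flips in the two bases agree on
such a state. A diagonal $U$ only multiplies the coherence $c$ by a phase, so the trace distance is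
at most $2|c|$, with equality for the sign flip. If $U$ or $V$ is scalar, $\rho$ does not change at
all.

The form is not unique, and the optimal unitaries may be diagonal in other bases than the given
ones. The concurrence is invariant under local unitaries and equals $2|c|$ in every such form
(`HasMCForm.concurrence_eq`), which makes the bound independent of the bases. -/

namespace DelocalisedGame

open Matrix

/-! ### Traces of positive semidefinite matrices and the functional calculus -/

open scoped MatrixOrder Matrix.Norms.L2Operator in
lemma trace_mul_re_nonneg {n : Type*} [Fintype n] [DecidableEq n] {A B : Matrix n n ℂ}
    (hA : A.PosSemidef) (hB : B.PosSemidef) : 0 ≤ (A * B).trace.re := by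
  obtain ⟨C, rfl⟩ := CStarAlgebra.nonneg_iff_eq_star_mul_self.mp hB.nonneg
  rw [← Matrix.mul_assoc, trace_mul_comm, ← Matrix.mul_assoc]
  exact (Complex.le_def.mp (hA.mul_mul_conjTranspose_same C).trace_nonneg).1

lemma continuousOn_spectrum {n : Type*} [Fintype n] [DecidableEq n] (A : Matrix n n ℂ)
    (f : ℝ → ℝ) : ContinuousOn f (spectrum ℝ A) :=
  (Matrix.finite_real_spectrum (A := A)).continuousOn f

open scoped MatrixOrder in
lemma posSemidef_cfc {n : Type*} [Fintype n] [DecidableEq n] (A : Matrix n n ℂ)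
    {f : ℝ → ℝ} (hf : ∀ x, 0 ≤ f x) : (cfc f A).PosSemidef :=
  nonneg_iff_posSemidef.mp (cfc_nonneg fun x _ => hf x)

lemma cfc_sqrt_conjTranspose_mul_self {n : Type*} [Fintype n] [DecidableEq n] {A : Matrix n n ℂ}
    (hA : A.IsHermitian) : cfc Real.sqrt (A.conjTranspose * A) = cfc (fun x : ℝ => |x|) A := by
  have hsa : IsSelfAdjoint A := hA
  have h : A.conjTranspose * A = cfc (fun x : ℝ => x ^ 2) A := by
    rw [cfc_pow_id (R := ℝ) A 2, hA.eq, pow_two]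
  rw [h, ← cfc_comp' Real.sqrt (fun x : ℝ => x ^ 2) A (Real.continuous_sqrt.continuousOn)
    (continuousOn_spectrum A _)]
  simp only [Real.sqrt_sq_eq_abs]

open scoped MatrixOrder in
lemma cfc_sqrt_mul_self {n : Type*} [Fintype n] [DecidableEq n] {A : Matrix n n ℂ}
    (hA : A.PosSemidef) : cfc Real.sqrt (A * A) = A := by
  have hsa : IsSelfAdjoint A := hA.1
  have h := cfc_sqrt_conjTranspose_mul_self hA.1
  rw [hA.1.eq] at h
  rw [h]
  conv_rhs => rw [← cfc_id ℝ A]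
  refine cfc_congr fun x hx => ?_
  exact abs_of_nonneg (spectrum_nonneg_of_nonneg (nonneg_iff_posSemidef.mpr hA) hx)

/-- The measurement bound of Helstrom. -/
lemma isGreatest_trace_effect {n : Type*} [Fintype n] [DecidableEq n] {X : Matrix n n ℂ}
    (hX : X.IsHermitian) (htr : X.trace = 0) :
    IsGreatest {t : ℝ | ∃ M : Matrix n n ℂ, M.PosSemidef ∧ (1 - M).PosSemidef ∧
      t = (M * X).trace.re} (1 / 2 * (cfc Real.sqrt (X.conjTranspose * X)).trace.re) := by
  have hsa : IsSelfAdjoint X := hX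
  have hc := continuousOn_spectrum X
  -- From $|x|=2\max(x,0)-x$; as $X$ is traceless, half its trace norm is the trace of its positive
  -- part $X_+$.
  have habs : cfc Real.sqrt (X.conjTranspose * X) =
      cfc (fun x : ℝ => max x 0) X + cfc (fun x : ℝ => max x 0) X - X := by
    rw [cfc_sqrt_conjTranspose_mul_self hX]
    conv_rhs => rw [← cfc_id' ℝ X (ha := hsa)]
    simp only [cfc_id' ℝ X (ha := hsa)]
    conv_rhs => rhs; rw [← cfc_id' ℝ X (ha := hsa)]
    rw [← cfc_add (hf := hc _) (hg := hc _), ← cfc_sub (hf := hc _) (hg := hc _)]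
    refine cfc_congr fun x _ => ?_
    rcases le_total x 0 with h | h
    · simp [h, abs_of_nonpos h]
    · simp [h, abs_of_nonneg h]
  have hval : 1 / 2 * (cfc Real.sqrt (X.conjTranspose * X)).trace.re =
      (cfc (fun x : ℝ => max x 0) X).trace.re := by
    rw [habs, trace_sub, trace_add, htr]
    simp
    ring
  rw [hval]
  constructor
  -- The optimal effect is the spectral projection onto the positive eigenvalues.
  · refine ⟨cfc (fun x : ℝ => if 0 < x then 1 else 0) X, ?_, ?_, ?_⟩
    · exact posSemidef_cfc X fun x => by split_ifs <;> norm_num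
    · rw [← cfc_one ℝ X, ← cfc_sub (hf := hc _) (hg := hc _)]
      exact posSemidef_cfc X fun x => by simp only [Pi.one_apply]; split_ifs <;> norm_num
    · congr 2
      conv_rhs => rhs; rw [← cfc_id' ℝ X (ha := hsa)]
      rw [← cfc_mul (hf := hc _) (hg := hc _)]
      refine cfc_congr fun x _ => ?_
      by_cases h : 0 < x
      · simp [h, h.le]
      · simp [h, not_lt.mp h]
  · rintro t ⟨M, hM, hM', rfl⟩
    -- $\mathrm{Tr}\,MX\le\mathrm{Tr}\,MX_+\le\mathrm{Tr}\,X_+$, because $X_+-X$ and $1-M$ are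
    -- positive semidefinite.
    have h1 := trace_mul_re_nonneg hM' (posSemidef_cfc X (f := fun x => max x 0) (by simp))
    have h2 := trace_mul_re_nonneg hM (posSemidef_cfc X (f := fun x => max x 0 - x) (by simp))
    rw [cfc_sub (hf := hc _) (hg := hc _), cfc_id' ℝ X] at h2
    simp only [Matrix.sub_mul, Matrix.mul_sub, Matrix.one_mul, trace_sub, Complex.sub_re] at h1 h2
    linarith

/-! ### The action of the interaction on the question states -/

lemma trace_ketbra_sandwich (ψ : Two → ℂ) (a b : Two) :
    (ketbra ψ * (ketbra (Pi.single a 1) * ketbra ψ * (ketbra (Pi.single b 1)).conjTranspose)).trace =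
      (ψ a * star (ψ a)) * (ψ b * star (ψ b)) := by
  simp [ketbra, conjTranspose_vecMulVec, vecMulVec_mul_vecMulVec, trace_vecMulVec,
    Pi.star_single]
  ring

/-- The interaction is diagonal in the occupation basis, so sandwiching it with $\psi$ leaves the
average of $1$, $U_A$, $V_B$ with weights $|\psi_x|^2$. The hypothesis removes the $U\otimes V$
term. -/
lemma trace_interaction (U V : Op1) (ρ M : Op2) (ψ : Two → ℂ) (h : ψ (1, 1) = 0) :
    ((M ⊗ₖ ketbra ψ) *
        (interaction U V * (ρ ⊗ₖ ketbra ψ) * (interaction U V).conjTranspose)).trace =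
      (M * (((ψ (0, 0) * star (ψ (0, 0))) • (1 : Op2) + (ψ (1, 0) * star (ψ (1, 0))) • onA U +
          (ψ (0, 1) * star (ψ (0, 1))) • onB V) * ρ *
        ((ψ (0, 0) * star (ψ (0, 0))) • (1 : Op2) + (ψ (1, 0) * star (ψ (1, 0))) • onA U +
          (ψ (0, 1) * star (ψ (0, 1))) • onB V).conjTranspose)).trace := by
  simp only [interaction, ket, conjTranspose_add, conjTranspose_kronecker, Matrix.add_mul,
    Matrix.mul_add, ← mul_kronecker_mul, trace_add, trace_kronecker, trace_ketbra_sandwich, h,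
    conjTranspose_smul, Matrix.smul_mul, Matrix.mul_smul, trace_smul, smul_eq_mul]
  simp
  ring

/-! ### The no-disturbance condition and the optimal measurement -/

lemma onA_mem {U : Op1} (hU : U ∈ unitaryGroup (Fin 2) ℂ) : onA U ∈ unitaryGroup Two ℂ :=
  kronecker_mem_unitary hU (one_mem _)

lemma onB_mem {V : Op1} (hV : V ∈ unitaryGroup (Fin 2) ℂ) : onB V ∈ unitaryGroup Two ℂ :=
  kronecker_mem_unitary (one_mem _) hV

lemma conjTranspose_mul_self_of_mem {n : Type*} [Fintype n] [DecidableEq n] {A : Matrix n n ℂ}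
    (h : A ∈ unitaryGroup n ℂ) : A.conjTranspose * A = 1 := mem_unitaryGroup_iff'.mp h

lemma mul_conjTranspose_self_of_mem {n : Type*} [Fintype n] [DecidableEq n] {A : Matrix n n ℂ}
    (h : A ∈ unitaryGroup n ℂ) : A * A.conjTranspose = 1 := mem_unitaryGroup_iff.mp h

lemma conjTranspose_mem {n : Type*} [Fintype n] [DecidableEq n] {A : Matrix n n ℂ}
    (h : A ∈ unitaryGroup n ℂ) : A.conjTranspose ∈ unitaryGroup n ℂ := Unitary.star_mem h

lemma trace_unitary_conj {n : Type*} [Fintype n] [DecidableEq n] {A : Matrix n n ℂ}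
    (h : A ∈ unitaryGroup n ℂ) (ρ : Matrix n n ℂ) :
    (A * ρ * A.conjTranspose).trace = ρ.trace := by
  rw [trace_mul_comm, ← Matrix.mul_assoc, conjTranspose_mul_self_of_mem h, Matrix.one_mul]

lemma trace_mul_conjTranspose_re_comm {n : Type*} [Fintype n] {ρ : Matrix n n ℂ}
    (hρ : ρ.IsHermitian) (A B : Matrix n n ℂ) :
    (B * ρ * A.conjTranspose).trace.re = (A * ρ * B.conjTranspose).trace.re := by
  have h : (B * ρ * A.conjTranspose).conjTranspose = A * ρ * B.conjTranspose := by
    simp [hρ.eq, Matrix.mul_assoc]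
  rw [← h, trace_conjTranspose]
  simp

lemma pnpState_weight :
    ((1 / √2 : ℝ) : ℂ) * star ((1 / √2 : ℝ) : ℂ) = 1 / 2 := by
  simp only [RCLike.star_def, Complex.conj_ofReal]
  rw [← Complex.ofReal_mul, div_mul_div_comm, Real.mul_self_sqrt (by norm_num)]
  norm_num

lemma trace_pnpState_true (U V : Op1) (ρ M : Op2) :
    ((M ⊗ₖ ketbra (pnpState true)) * (interaction U V * (ρ ⊗ₖ ketbra (pnpState true)) *
        (interaction U V).conjTranspose)).trace =
      (M * (((1 / 2 : ℂ) • onA U + (1 / 2 : ℂ) • onB V) * ρ *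
        ((1 / 2 : ℂ) • onA U + (1 / 2 : ℂ) • onB V).conjTranspose)).trace := by
  have h00 : pnpState true (0, 0) = 0 := by simp [pnpState, ket]
  have h11 : pnpState true (1, 1) = 0 := by simp [pnpState, ket]
  have h10 : pnpState true (1, 0) = ((1 / √2 : ℝ) : ℂ) := by simp [pnpState, ket]
  have h01 : pnpState true (0, 1) = ((1 / √2 : ℝ) : ℂ) := by simp [pnpState, ket]
  rw [trace_interaction _ _ _ _ _ h11, h00, h10, h01, pnpState_weight]
  simp

lemma trace_pnpState_false (U V : Op1) (ρ M : Op2) :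
    ((M ⊗ₖ ketbra (pnpState false)) * (interaction U V * (ρ ⊗ₖ ketbra (pnpState false)) *
        (interaction U V).conjTranspose)).trace = (M * ρ).trace := by
  have h00 : pnpState false (0, 0) = 1 := by simp [pnpState, ket]
  have h11 : pnpState false (1, 1) = 0 := by simp [pnpState, ket]
  have h10 : pnpState false (1, 0) = 0 := by simp [pnpState, ket]
  have h01 : pnpState false (0, 1) = 0 := by simp [pnpState, ket]
  rw [trace_interaction _ _ _ _ _ h11, h00, h10, h01]
  simp

lemma neverDisturbs_iff_trace {ρ : Op2} (hρ : IsDensity ρ) {U V : Op1}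
    (hU : U ∈ unitaryGroup (Fin 2) ℂ) (hV : V ∈ unitaryGroup (Fin 2) ℂ) :
    NeverDisturbs ρ U V ↔ (onA U * ρ * (onB V).conjTranspose).trace.re = 1 := by
  have hA := trace_unitary_conj (onA_mem hU) ρ
  have hB := trace_unitary_conj (onB_mem hV) ρ
  have hAB := trace_mul_conjTranspose_re_comm hρ.1.1 (onA U) (onB V)
  rw [hρ.2] at hA hB
  have ht : returnProb (pnpState true) (interaction U V) ρ =
      1 / 2 + 1 / 2 * (onA U * ρ * (onB V).conjTranspose).trace.re := by
    rw [returnProb, trace_pnpState_true]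
    simp only [Matrix.one_mul, conjTranspose_add, conjTranspose_smul, Matrix.add_mul,
      Matrix.mul_add, Matrix.smul_mul, Matrix.mul_smul, trace_add, trace_smul, hA, hB, smul_eq_mul,
      Complex.add_re]
    have e : ∀ z : ℂ, (star (1 / 2 : ℂ) * (1 / 2 * z)).re = 1 / 4 * z.re := fun z => by
      have : star (1 / 2 : ℂ) * (1 / 2 * z) = ((1 / 4 : ℝ) : ℂ) * z := by
        simp; ring
      rw [this, Complex.re_ofReal_mul]
    rw [← mul_add, e, ← mul_add, e, Complex.add_re, Complex.add_re, hAB]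
    simp
    ring
  have hf : returnProb (pnpState false) (interaction U V) ρ = 1 := by
    rw [returnProb, trace_pnpState_false, Matrix.one_mul, hρ.2, Complex.one_re]
  simp only [NeverDisturbs, Bool.forall_bool, ht, hf, true_and]
  constructor <;> intro h <;> linarith

open scoped MatrixOrder Matrix.Norms.L2Operator in
-- Writing $\rho=C^\dagger C$ turns the trace into the squared Frobenius norm of $DC^\dagger$.
lemma mul_eq_zero_of_trace_eq_zero {n : Type*} [Fintype n] [DecidableEq n] {ρ : Matrix n n ℂ}
    (hρ : ρ.PosSemidef) {D : Matrix n n ℂ} (h : (D * ρ * D.conjTranspose).trace = 0) :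
    D * ρ = 0 := by
  obtain ⟨C, rfl⟩ := CStarAlgebra.nonneg_iff_eq_star_mul_self.mp hρ.nonneg
  have h' : D * C.conjTranspose = 0 := by
    rw [← conjTranspose_eq_zero, ← trace_conjTranspose_mul_self_eq_zero_iff]
    simpa [star_eq_conjTranspose, Matrix.mul_assoc] using h
  rw [star_eq_conjTranspose, ← Matrix.mul_assoc, h', Matrix.zero_mul]

lemma neverDisturbs_iff_mul_eq {ρ : Op2} (hρ : IsDensity ρ) {U V : Op1}
    (hU : U ∈ unitaryGroup (Fin 2) ℂ) (hV : V ∈ unitaryGroup (Fin 2) ℂ) :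
    NeverDisturbs ρ U V ↔ onA U * ρ = onB V * ρ := by
  rw [neverDisturbs_iff_trace hρ hU hV]
  have hA := trace_unitary_conj (onA_mem hU) ρ
  have hB := trace_unitary_conj (onB_mem hV) ρ
  have hAB := trace_mul_conjTranspose_re_comm hρ.1.1 (onA U) (onB V)
  rw [hρ.2] at hA hB
  constructor
  · intro h
    have hps := (hρ.1.mul_mul_conjTranspose_same (onA U - onB V)).trace_nonneg
    -- The real part is $1+1-2\,\mathrm{Re}\,\mathrm{Tr}(U_A\rho V_B^\dagger)=0$.
    have h0 : ((onA U - onB V) * ρ * (onA U - onB V).conjTranspose).trace = 0 := by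
      apply Complex.ext
      · simp only [conjTranspose_sub, Matrix.sub_mul, Matrix.mul_sub, trace_sub, hA, hB,
          Complex.sub_re, hAB, h]
        simp
      · exact (Complex.le_def.mp hps).2.symm
    have := mul_eq_zero_of_trace_eq_zero hρ.1 h0
    rwa [Matrix.sub_mul, sub_eq_zero] at this
  · intro h
    rw [h, hB, Complex.one_re]

lemma pnpWinProb_of_mul_eq {ρ : Op2} (hρ : IsDensity ρ) {U V : Op1}
    (h : onA U * ρ = onB V * ρ) {M : Bool → Op2} (hM : ∑ z, M z = 1) :
    pnpWinProb ρ U V M = 1 / 2 * (1 + (M true * (conjA U ρ - ρ)).trace.re) := by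
  have hf : M false = 1 - M true := by
    rw [Fintype.sum_bool] at hM
    rw [← hM, add_sub_cancel_left]
  have hK : ((1 / 2 : ℂ) • onA U + (1 / 2 : ℂ) • onB V) * ρ = onA U * ρ := by
    rw [Matrix.add_mul, Matrix.smul_mul, Matrix.smul_mul, ← h, ← add_smul]
    norm_num
  have hK' : ρ * ((1 / 2 : ℂ) • onA U + (1 / 2 : ℂ) • onB V).conjTranspose =
      ρ * (onA U).conjTranspose := by
    have := congrArg conjTranspose hK
    simpa only [conjTranspose_mul, hρ.1.1.eq] using this
  rw [pnpWinProb, winProb, Fintype.sum_bool, trace_pnpState_true, trace_pnpState_false, hf,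
    Matrix.mul_assoc _ ρ, hK', ← Matrix.mul_assoc _ ρ, hK, conjA]
  simp only [Matrix.mul_sub, Matrix.sub_mul, Matrix.one_mul, trace_sub, Complex.sub_re, hρ.2,
    Complex.one_re]
  ring

lemma isGreatest_pnpWinProb {ρ : Op2} (hρ : IsDensity ρ) {U V : Op1} (h : Admissible ρ U V) :
    IsGreatest {p : ℝ | ∃ M, IsPOVM M ∧ p = pnpWinProb ρ U V M}
      (1 / 2 * (1 + traceDist (conjA U ρ) ρ)) := by
  have heq := (neverDisturbs_iff_mul_eq hρ h.1 h.2.1).mp h.2.2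
  have hX : (conjA U ρ - ρ).IsHermitian :=
    (hρ.1.mul_mul_conjTranspose_same (onA U)).1.sub hρ.1.1
  have htr : (conjA U ρ - ρ).trace = 0 := by
    rw [trace_sub, conjA, trace_unitary_conj (onA_mem h.1), sub_self]
  have hel := isGreatest_trace_effect hX htr
  rw [traceDist]
  constructor
  · obtain ⟨M, hM, hM', ht⟩ := hel.1
    have hsum : ∑ z : Bool, (if z then M else 1 - M) = 1 := by simp
    refine ⟨fun z => if z then M else 1 - M, ⟨?_, hsum⟩, ?_⟩
    · rintro (_ | _)
      · simpa using hM'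
      · simpa using hM
    · rw [pnpWinProb_of_mul_eq hρ heq hsum, ht]
      rfl
  · rintro p ⟨M, ⟨hM, hsum⟩, rfl⟩
    rw [pnpWinProb_of_mul_eq hρ heq hsum]
    have hf : M false = 1 - M true := by
      rw [Fintype.sum_bool] at hsum
      rw [← hsum, add_sub_cancel_left]
    have := hel.2 ⟨M true, hM true, hf ▸ hM false, rfl⟩
    linarith

/-! ### Maximally correlated states from strong anonymity -/

lemma exists_unitary_fst_col {v : Fin 2 → ℂ} (hv : v ≠ 0) :
    ∃ S ∈ unitaryGroup (Fin 2) ℂ, ∃ k : ℂ, ∀ i, S i 0 = k * v i := by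
  set n : ℝ := Complex.normSq (v 0) + Complex.normSq (v 1) with hn
  have hpos : 0 < n := by
    have h0 := Complex.normSq_nonneg (v 0)
    have h1 := Complex.normSq_nonneg (v 1)
    refine lt_of_le_of_ne (by positivity) fun h => hv ?_
    have e0 : Complex.normSq (v 0) = 0 := by linarith
    have e1 : Complex.normSq (v 1) = 0 := by linarith
    ext i
    fin_cases i
    · exact Complex.normSq_eq_zero.mp e0
    · exact Complex.normSq_eq_zero.mp e1
  have hk : (((√n)⁻¹ : ℝ) : ℂ) * (((√n)⁻¹ : ℝ) : ℂ) * (v 0 * conj (v 0) + v 1 * conj (v 1)) = 1 := by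
    rw [Complex.mul_conj, Complex.mul_conj, ← Complex.ofReal_add, ← hn, ← Complex.ofReal_mul,
      ← Complex.ofReal_mul, ← mul_inv, Real.mul_self_sqrt hpos.le, inv_mul_cancel₀ hpos.ne',
      Complex.ofReal_one]
  rw [Complex.ofReal_inv] at hk
  refine ⟨(((√n)⁻¹ : ℝ) : ℂ) • !![v 0, -conj (v 1); v 1, conj (v 0)], ?_, (((√n)⁻¹ : ℝ) : ℂ), ?_⟩
  · rw [mem_unitaryGroup_iff']
    ext i j
    fin_cases i <;> fin_cases j <;>
      simp [Matrix.mul_apply, Fin.sum_univ_two] <;>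
      first | linear_combination hk | ring
  · intro i
    fin_cases i <;> simp

/-- With an eigenvector as first column of $S$, the conjugated matrix is upper triangular, and a
unitary upper triangular matrix is diagonal. -/
lemma unitary_exists_diagonal {U : Op1} (hU : U ∈ unitaryGroup (Fin 2) ℂ) :
    ∃ S ∈ unitaryGroup (Fin 2) ℂ, ∃ d : Fin 2 → ℂ, S.conjTranspose * U * S = diagonal d := by
  obtain ⟨μ, hμ⟩ := Module.End.exists_eigenvalue (Matrix.toLin' U)
  obtain ⟨v, hv⟩ := hμ.exists_hasEigenvector
  have hUv : U *ᵥ v = μ • v := by simpa using hv.apply_eq_smul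
  obtain ⟨S, hS, k, hk⟩ := exists_unitary_fst_col hv.2
  set X := S.conjTranspose * U * S with hX
  have hXmem : X ∈ unitaryGroup (Fin 2) ℂ := mul_mem (mul_mem (conjTranspose_mem hS) hU) hS
  have hcol : ∀ i, X i 0 = μ * (1 : Op1) i 0 := by
    intro i
    have h1 : ∀ j, (U * S) j 0 = μ * S j 0 := by
      intro j
      have := congrFun hUv j
      simp only [mulVec, dotProduct, Fin.sum_univ_two, Pi.smul_apply, smul_eq_mul] at this
      simp only [Matrix.mul_apply, Fin.sum_univ_two, hk]
      linear_combination k * this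
    rw [hX, Matrix.mul_assoc, Matrix.mul_apply, ← conjTranspose_mul_self_of_mem hS,
      Matrix.mul_apply, Finset.mul_sum]
    exact Finset.sum_congr rfl fun j _ => by rw [h1]; ring
  have h10 : X 1 0 = 0 := by simpa using hcol 1
  have hXX := conjTranspose_mul_self_of_mem hXmem
  have e00 := congrFun (congrFun hXX 0) 0
  have e01 := congrFun (congrFun hXX 0) 1
  simp [Matrix.mul_apply, Fin.sum_univ_two, h10] at e00 e01
  -- Orthogonality of the columns reads $\overline{X_{00}}X_{01}=0$, and $X_{00}\ne0$ since the
  -- first column has norm one.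
  have h01 : X 0 1 = 0 := e01.resolve_left fun h => by simp [h] at e00
  refine ⟨S, hS, ![X 0 0, X 1 1], ?_⟩
  rw [← hX]
  ext i j
  fin_cases i <;> fin_cases j <;> simp [h10, h01]

lemma eq_conj_of_conj_eq {n : Type*} [Fintype n] [DecidableEq n] {S U D : Matrix n n ℂ}
    (hS : S ∈ unitaryGroup n ℂ) (h : S.conjTranspose * U * S = D) :
    U = S * D * S.conjTranspose := by
  rw [← h]
  simp only [Matrix.mul_assoc, mul_conjTranspose_self_of_mem hS, Matrix.mul_one]
  rw [← Matrix.mul_assoc, mul_conjTranspose_self_of_mem hS, Matrix.one_mul]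

lemma conj_eq_of_eq_conj {n : Type*} [Fintype n] [DecidableEq n] {S U D : Matrix n n ℂ}
    (hS : S ∈ unitaryGroup n ℂ) (h : U = S * D * S.conjTranspose) :
    S.conjTranspose * U * S = D := by
  rw [h]
  simp only [Matrix.mul_assoc, conjTranspose_mul_self_of_mem hS, Matrix.mul_one]
  rw [← Matrix.mul_assoc, conjTranspose_mul_self_of_mem hS, Matrix.one_mul]

lemma NonScalar.ne {U S : Op1} (hU : NonScalar U) (hS : S ∈ unitaryGroup (Fin 2) ℂ)
    {d : Fin 2 → ℂ} (h : S.conjTranspose * U * S = diagonal d) : d 0 ≠ d 1 := by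
  intro hd
  apply hU (d 0)
  have hD : diagonal d = d 0 • (1 : Op1) := by
    ext i j
    fin_cases i <;> fin_cases j <;> simp [hd]
  rw [eq_conj_of_conj_eq hS h, hD]
  simp [mul_conjTranspose_self_of_mem hS]

lemma onA_conj {S T : Op1} (hT : T ∈ unitaryGroup (Fin 2) ℂ) (D : Op1) :
    onA (S * D * S.conjTranspose) = (S ⊗ₖ T) * onA D * (S ⊗ₖ T).conjTranspose := by
  simp only [onA, conjTranspose_kronecker, ← mul_kronecker_mul, Matrix.mul_one,
    mul_conjTranspose_self_of_mem hT]

lemma onB_conj {S T : Op1} (hS : S ∈ unitaryGroup (Fin 2) ℂ) (D : Op1) :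
    onB (T * D * T.conjTranspose) = (S ⊗ₖ T) * onB D * (S ⊗ₖ T).conjTranspose := by
  simp only [onB, conjTranspose_kronecker, ← mul_kronecker_mul, Matrix.mul_one,
    mul_conjTranspose_self_of_mem hS]

lemma conj_mul_conj {n : Type*} [Fintype n] [DecidableEq n] {W : Matrix n n ℂ}
    (hW : W ∈ unitaryGroup n ℂ) (A B : Matrix n n ℂ) :
    (W * A * W.conjTranspose) * (W * B * W.conjTranspose) = W * (A * B) * W.conjTranspose := by
  simp only [Matrix.mul_assoc]
  rw [← Matrix.mul_assoc W.conjTranspose W, conjTranspose_mul_self_of_mem hW, Matrix.one_mul]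

lemma eq_mcMatrix {σ : Op2} (hσ : σ.IsHermitian) (htr : σ.trace = 1)
    (h01 : ∀ x, σ (0, 1) x = 0) (h10 : ∀ x, σ (1, 0) x = 0) :
    σ = mcMatrix (σ (0, 0) (0, 0)).re (σ (0, 0) (1, 1)) := by
  have h01' : ∀ x, σ x (0, 1) = 0 := fun x => by rw [← hσ.apply, h01, star_zero]
  have h10' : ∀ x, σ x (1, 0) = 0 := fun x => by rw [← hσ.apply, h10, star_zero]
  have hr : ((σ (0, 0) (0, 0)).re : ℂ) = σ (0, 0) (0, 0) :=
    Complex.conj_eq_iff_re.mp (hσ.apply _ _)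
  have hc : conj (σ (0, 0) (1, 1)) = σ (1, 1) (0, 0) := hσ.apply _ _
  have h11 : σ (1, 1) (1, 1) = 1 - σ (0, 0) (0, 0) := by
    simp only [trace, diag, Fintype.sum_prod_type, Fin.sum_univ_two, h01, h10] at htr
    linear_combination htr
  ext ⟨i, j⟩ ⟨k, l⟩
  fin_cases i <;> fin_cases j <;> fin_cases k <;> fin_cases l <;>
    simp [mcMatrix, h01, h10, h01', h10', hr, hc, h11]

lemma hasMCForm_of_eigenvalues_ne {ρ : Op2} (hρ : IsDensity ρ) {U V S T : Op1}
    (h : onA U * ρ = onB V * ρ) (hS : S ∈ unitaryGroup (Fin 2) ℂ)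
    (hT : T ∈ unitaryGroup (Fin 2) ℂ) {d e : Fin 2 → ℂ}
    (hd : S.conjTranspose * U * S = diagonal d) (he : T.conjTranspose * V * T = diagonal e)
    (h01 : d 0 ≠ e 1) (h10 : d 1 ≠ e 0) : ∃ r c, HasMCForm ρ S T r c := by
  have hW : S ⊗ₖ T ∈ unitaryGroup Two ℂ := kronecker_mem_unitary hS hT
  set W := S ⊗ₖ T with hWdef
  set σ := W.conjTranspose * ρ * W with hσdef
  have hρσ : ρ = W * σ * W.conjTranspose := eq_conj_of_conj_eq hW rfl
  have hσ : σ.PosSemidef := hρ.1.conjTranspose_mul_mul_same W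
  have htr : σ.trace = 1 := by
    rw [← hρ.2, hρσ, trace_unitary_conj hW]
  have key : onA (diagonal d) * σ = onB (diagonal e) * σ := by
    rw [eq_conj_of_conj_eq hS hd, eq_conj_of_conj_eq hT he, onA_conj hT, onB_conj hS, ← hWdef,
      hρσ, conj_mul_conj hW, conj_mul_conj hW] at h
    exact (conj_eq_of_eq_conj hW rfl).symm.trans (conj_eq_of_eq_conj hW h)
  have hent : ∀ i j x, d i * σ (i, j) x = e j * σ (i, j) x := by
    intro i j x
    have := congrFun (congrFun key (i, j)) x
    rwa [onA, onB, ← diagonal_one, diagonal_kronecker_diagonal, diagonal_kronecker_diagonal,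
      diagonal_mul, diagonal_mul, one_mul, mul_one] at this
  have hmc := eq_mcMatrix hσ.1 htr
    (fun x => (mul_eq_mul_right_iff.mp (hent 0 1 x)).resolve_left h01)
    (fun x => (mul_eq_mul_right_iff.mp (hent 1 0 x)).resolve_left h10)
  exact ⟨_, _, hS, hT, hmc ▸ hρσ⟩

/-- The form `mcMatrix` in common eigenbases of the local unitaries. -/
lemma exists_hasMCForm {ρ : Op2} (hρ : IsDensity ρ) {U V : Op1}
    (hU : U ∈ unitaryGroup (Fin 2) ℂ) (hV : V ∈ unitaryGroup (Fin 2) ℂ)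
    (hU' : NonScalar U) (hV' : NonScalar V) (h : onA U * ρ = onB V * ρ) :
    ∃ S T r c, HasMCForm ρ S T r c ∧ (∃ d, S.conjTranspose * U * S = diagonal d) ∧
      ∃ e, T.conjTranspose * V * T = diagonal e := by
  obtain ⟨S, hS, d, hd⟩ := unitary_exists_diagonal hU
  obtain ⟨T, hT, e, he⟩ := unitary_exists_diagonal hV
  have hdne := hU'.ne hS hd
  have hene := hV'.ne hT he
  by_cases hcase : d 0 ≠ e 1 ∧ d 1 ≠ e 0
  · obtain ⟨r, c, hrc⟩ := hasMCForm_of_eigenvalues_ne hρ h hS hT hd he hcase.1 hcase.2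
    exact ⟨S, T, r, c, hrc, ⟨d, hd⟩, e, he⟩
  -- Here $d_0=e_1$ or $d_1=e_0$. Either one, with $d_0\ne d_1$ and $e_0\ne e_1$, gives $d_0\ne e_0$
  -- and $d_1\ne e_1$, which is what the swapped basis of $B$ needs.
  · have hP : (!![0, 1; 1, 0] : Op1) ∈ unitaryGroup (Fin 2) ℂ := by
      rw [mem_unitaryGroup_iff']
      ext i j
      fin_cases i <;> fin_cases j <;> simp [Matrix.mul_apply, Fin.sum_univ_two]
    set T' := T * !![0, 1; 1, 0] with hT'
    have he' : T'.conjTranspose * V * T' = diagonal ![e 1, e 0] := by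
      have : T'.conjTranspose * V * T' =
          (!![0, 1; 1, 0] : Op1).conjTranspose * (T.conjTranspose * V * T) * !![0, 1; 1, 0] := by
        simp only [hT', conjTranspose_mul, Matrix.mul_assoc]
      rw [this, he]
      ext i j
      fin_cases i <;> fin_cases j <;> simp [Matrix.mul_apply, Fin.sum_univ_two]
    have hne : d 0 ≠ e 0 ∧ d 1 ≠ e 1 := by
      rw [not_and_or, not_not, not_not] at hcase
      rcases hcase with hc | hc
      · exact ⟨hc ▸ hene.symm, hc ▸ hdne.symm⟩
      · exact ⟨hc ▸ hdne, hc ▸ hene⟩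
    obtain ⟨r, c, hrc⟩ := hasMCForm_of_eigenvalues_ne hρ h hS (mul_mem hT hP) hd he'
      (by simpa using hne.1) (by simpa using hne.2)
    exact ⟨S, T', r, c, hrc, ⟨d, hd⟩, _, he'⟩

/-! ### Sign flips of maximally correlated states -/

/-- The unitary with eigenvalues `1` and `-1` on the columns of `S`. -/
def signFlip (S : Op1) : Op1 := S * diagonal ![1, -1] * S.conjTranspose

lemma signFlip_mem {S : Op1} (hS : S ∈ unitaryGroup (Fin 2) ℂ) :
    signFlip S ∈ unitaryGroup (Fin 2) ℂ := by
  refine mul_mem (mul_mem hS ?_) (conjTranspose_mem hS)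
  rw [mem_unitaryGroup_iff']
  ext i j
  fin_cases i <;> fin_cases j <;> simp [star_eq_conjTranspose, diagonal_conjTranspose]

lemma signFlip_nonScalar {S : Op1} (hS : S ∈ unitaryGroup (Fin 2) ℂ) :
    NonScalar (signFlip S) := by
  intro z hz
  have h := conj_eq_of_eq_conj hS (rfl : signFlip S = _)
  rw [hz, Matrix.mul_smul, Matrix.mul_one, Matrix.smul_mul, conjTranspose_mul_self_of_mem hS] at h
  have h0 := congrFun (congrFun h 0) 0
  have h1 := congrFun (congrFun h 1) 1
  simp at h0 h1
  rw [h0] at h1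
  norm_num at h1

/-- Both flips act as $+1$ on $|00\rangle$ and $-1$ on $|11\rangle$, and in the adapted bases the
other rows of the state vanish. -/
lemma onA_signFlip_mul_eq {ρ : Op2} {S T : Op1} {r : ℝ} {c : ℂ} (h : HasMCForm ρ S T r c) :
    onA (signFlip S) * ρ = onB (signFlip T) * ρ := by
  obtain ⟨hS, hT, rfl⟩ := h
  have hW : S ⊗ₖ T ∈ unitaryGroup Two ℂ := kronecker_mem_unitary hS hT
  rw [signFlip, signFlip, onA_conj hT, onB_conj hS, conj_mul_conj hW, conj_mul_conj hW]
  congr 2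
  rw [onA, onB, ← diagonal_one, diagonal_kronecker_diagonal, diagonal_kronecker_diagonal]
  ext ⟨i, j⟩ ⟨k, l⟩
  rw [diagonal_mul, diagonal_mul]
  fin_cases i <;> fin_cases j <;> simp [mcMatrix, Matrix.single_apply]

lemma HasMCForm.stronglyAnonymous {ρ : Op2} {S T : Op1} {r : ℝ} {c : ℂ}
    (h : HasMCForm ρ S T r c) : StronglyAnonymous ρ :=
  ⟨signFlip S, signFlip_mem h.1, signFlip T, signFlip_mem h.2.1, signFlip_nonScalar h.1,
    signFlip_nonScalar h.2.1, onA_signFlip_mul_eq h⟩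

/-! ### The trace distance reached by local unitaries -/

/-- `δ |00⟩⟨11| + δ* |11⟩⟨00|`. -/
def coherence (δ : ℂ) : Op2 :=
  δ • Matrix.single (0, 0) (1, 1) 1 + conj δ • Matrix.single (1, 1) (0, 0) 1

lemma traceDist_of_sub_eq {ρ σ W : Op2} (hW : W ∈ unitaryGroup Two ℂ) {δ : ℂ}
    (h : ρ - σ = W * coherence δ * W.conjTranspose) : traceDist ρ σ = ‖δ‖ := by
  -- The absolute value of the coherence: $|\delta|$ times the projection onto the span of
  -- $|00\rangle$ and $|11\rangle$, of trace $2|\delta|$.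
  set H : Op2 := diagonal fun x => if x = (0, 0) ∨ x = (1, 1) then (‖δ‖ : ℂ) else 0 with hH
  have hHps : H.PosSemidef := by
    refine PosSemidef.diagonal fun x => ?_
    dsimp only [Pi.zero_apply]
    split_ifs
    · exact Complex.zero_le_real.mpr (norm_nonneg δ)
    · exact le_rfl
  have hsq : (coherence δ).conjTranspose * coherence δ = H * H := by
    have e1 := Complex.conj_mul' δ
    have e2 := Complex.mul_conj' δ
    ext ⟨i, j⟩ ⟨k, l⟩
    fin_cases i <;> fin_cases j <;> fin_cases k <;> fin_cases l <;>
      simp [coherence, hH, Matrix.mul_apply, Matrix.single_apply, diagonal_apply, e1, e2, pow_two]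
  have hconj : (ρ - σ).conjTranspose * (ρ - σ) =
      (W * H * W.conjTranspose) * (W * H * W.conjTranspose) := by
    rw [conj_mul_conj hW, ← hsq, ← conj_mul_conj hW, h]
    simp only [conjTranspose_mul, conjTranspose_conjTranspose, Matrix.mul_assoc]
  rw [traceDist, hconj, cfc_sqrt_mul_self (hHps.mul_mul_conjTranspose_same W),
    trace_unitary_conj hW]
  simp [hH, trace, Fintype.sum_prod_type]
  ring

lemma eigenvalue_mul_conj {U S : Op1} (hU : U ∈ unitaryGroup (Fin 2) ℂ)
    (hS : S ∈ unitaryGroup (Fin 2) ℂ) {d : Fin 2 → ℂ}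
    (h : S.conjTranspose * U * S = diagonal d) (i : Fin 2) : d i * conj (d i) = 1 := by
  have hD : diagonal d ∈ unitaryGroup (Fin 2) ℂ :=
    h ▸ mul_mem (mul_mem (conjTranspose_mem hS) hU) hS
  have := congrFun (congrFun (mul_conjTranspose_self_of_mem hD) i) i
  simpa [diagonal_conjTranspose] using this

/-- Conjugation by the diagonalised $U$ fixes the populations, since $|d_i|=1$, and multiplies $c$
by $d_0\overline{d_1}$. -/
lemma traceDist_conjA {ρ : Op2} {S T : Op1} {r : ℝ} {c : ℂ} (hρ : HasMCForm ρ S T r c)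
    {U : Op1} (hU : U ∈ unitaryGroup (Fin 2) ℂ) {d : Fin 2 → ℂ}
    (h : S.conjTranspose * U * S = diagonal d) :
    traceDist (conjA U ρ) ρ = ‖d 0 * conj (d 1) - 1‖ * ‖c‖ := by
  have h0 := eigenvalue_mul_conj hU hρ.1 h 0
  have h1 := eigenvalue_mul_conj hU hρ.1 h 1
  obtain ⟨hS, hT, rfl⟩ := hρ
  have hW : S ⊗ₖ T ∈ unitaryGroup Two ℂ := kronecker_mem_unitary hS hT
  rw [← norm_mul]
  refine traceDist_of_sub_eq hW ?_
  have hct : ∀ A : Op2, (S ⊗ₖ T * A * (S ⊗ₖ T).conjTranspose).conjTranspose =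
      S ⊗ₖ T * A.conjTranspose * (S ⊗ₖ T).conjTranspose := fun A => by
    simp only [conjTranspose_mul, conjTranspose_conjTranspose, Matrix.mul_assoc]
  rw [conjA, eq_conj_of_conj_eq hS h, onA_conj hT, hct, conj_mul_conj hW, conj_mul_conj hW,
    ← Matrix.sub_mul, ← Matrix.mul_sub]
  congr 2
  rw [onA, ← diagonal_one, diagonal_kronecker_diagonal, diagonal_conjTranspose]
  ext ⟨i, j⟩ ⟨k, l⟩
  rw [Matrix.sub_apply, mul_diagonal, diagonal_mul]
  fin_cases i <;> fin_cases j <;> fin_cases k <;> fin_cases l <;>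
    simp [mcMatrix, coherence]
  · linear_combination (r : ℂ) * h0
  · ring
  · ring
  · linear_combination (1 - r : ℂ) * h1

lemma conjA_eq_of_left_scalar {ρ : Op2} {U : Op1} (hU : U ∈ unitaryGroup (Fin 2) ℂ) {z : ℂ}
    (hz : U = z • (1 : Op1)) : conjA U ρ = ρ := by
  have hA : onA U = z • (1 : Op2) := by
    rw [hz, onA, smul_kronecker, one_kronecker_one]
  have h1 := mul_conjTranspose_self_of_mem (onA_mem hU)
  rw [conjA]
  rw [hA, conjTranspose_smul, conjTranspose_one] at h1 ⊢
  simp only [Matrix.smul_mul, Matrix.mul_smul, Matrix.mul_one, Matrix.one_mul] at h1 ⊢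
  rw [smul_smul] at h1 ⊢
  have h2 : (star z * z) • ρ = ((star z * z) • (1 : Op2)) * ρ := by simp
  rw [h2, h1, Matrix.one_mul]

lemma conjA_eq_of_right_scalar {ρ : Op2} (hρ : ρ.IsHermitian) {U V : Op1}
    (hV : V ∈ unitaryGroup (Fin 2) ℂ) (h : onA U * ρ = onB V * ρ) {z : ℂ}
    (hz : V = z • (1 : Op1)) : conjA U ρ = ρ := by
  have hB : onB V = onA V := by
    rw [hz, onA, onB, smul_kronecker, kronecker_smul]
  have h' : ρ * (onA U).conjTranspose = ρ * (onA V).conjTranspose := by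
    have := congrArg conjTranspose h
    simpa only [conjTranspose_mul, hρ.eq, hB] using this
  rw [conjA, Matrix.mul_assoc, h', ← Matrix.mul_assoc, h, hB]
  exact conjA_eq_of_left_scalar hV hz

lemma traceDist_self (ρ : Op2) : traceDist ρ ρ = 0 := by
  rw [traceDist_of_sub_eq (W := 1) (δ := 0) (one_mem _) (by simp [coherence]), norm_zero]

/-! ### The concurrence of maximally correlated states -/

lemma pauliY_mul_self : pauliY * pauliY = 1 := by
  ext i j
  fin_cases i <;> fin_cases j <;> simp [pauliY, Matrix.mul_apply, Fin.sum_univ_two]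

lemma pauliY_conjTranspose : pauliY.conjTranspose = pauliY := by
  ext i j
  fin_cases i <;> fin_cases j <;> simp [pauliY]

/-- $Y$ is an antisymmetric form on a two-dimensional space, so a change of basis only scales it by
the determinant. -/
lemma transpose_mul_pauliY_mul (S : Op1) : S.transpose * pauliY * S = S.det • pauliY := by
  ext i j
  fin_cases i <;> fin_cases j <;>
    simp [pauliY, Matrix.mul_apply, Fin.sum_univ_two, det_fin_two] <;> ring

lemma pauliY_mul_map_conj_mul_pauliY {S : Op1} (hS : S ∈ unitaryGroup (Fin 2) ℂ) :
    pauliY * S.map conj * pauliY = conj S.det • S := by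
  have h1 : S.map conj * S.transpose = 1 := by
    have := congrArg transpose (mul_conjTranspose_self_of_mem hS)
    simpa [transpose_mul, conjTranspose, transpose_map] using this
  have h2 : pauliY * S = S.det • (S.map conj * pauliY) := by
    rw [← Matrix.mul_smul, ← transpose_mul_pauliY_mul, ← Matrix.mul_assoc, ← Matrix.mul_assoc, h1,
      Matrix.one_mul]
  have h3 : conj S.det * S.det = 1 := by
    have := congrArg det (conjTranspose_mul_self_of_mem hS)
    simpa [det_conjTranspose] using this
  have h4 : S.map conj * pauliY = conj S.det • (pauliY * S) := by
    rw [h2, smul_smul, h3, one_smul]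
  rw [Matrix.mul_assoc, h4, Matrix.mul_smul, ← Matrix.mul_assoc, pauliY_mul_self, Matrix.one_mul]

/-- $Y\otimes Y$ turns the entrywise conjugate of $S\otimes T$ back into $S\otimes T$ up to a phase,
and the phases from the two sides cancel. -/
lemma spinFlip_conj {S T : Op1} (hS : S ∈ unitaryGroup (Fin 2) ℂ)
    (hT : T ∈ unitaryGroup (Fin 2) ℂ) (σ : Op2) :
    spinFlip (S ⊗ₖ T * σ * (S ⊗ₖ T).conjTranspose) =
      S ⊗ₖ T * spinFlip σ * (S ⊗ₖ T).conjTranspose := by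
  set W : Op2 := S ⊗ₖ T with hW
  set Y : Op2 := pauliY ⊗ₖ pauliY with hY
  have hYY : Y * Y = 1 := by
    rw [hY, ← mul_kronecker_mul, pauliY_mul_self, one_kronecker_one]
  have hYh : Y.conjTranspose = Y := by
    rw [hY, conjTranspose_kronecker, pauliY_conjTranspose]
  have hmap : W.map conj = S.map conj ⊗ₖ T.map conj := by
    ext x y
    simp [hW]
  obtain ⟨k, hk, hWk⟩ : ∃ k : ℂ, k * conj k = 1 ∧ Y * W.map conj * Y = k • W := by
    refine ⟨conj S.det * conj T.det, ?_, ?_⟩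
    · have h1 := congrArg det (conjTranspose_mul_self_of_mem hS)
      have h2 := congrArg det (conjTranspose_mul_self_of_mem hT)
      simp only [det_mul, det_conjTranspose, det_one, RCLike.star_def] at h1 h2
      simp only [map_mul, Complex.conj_conj]
      linear_combination conj T.det * T.det * h1 + h2
    · rw [hmap, hY, ← mul_kronecker_mul, ← mul_kronecker_mul,
        pauliY_mul_map_conj_mul_pauliY hS, pauliY_mul_map_conj_mul_pauliY hT, smul_kronecker,
        kronecker_smul, smul_smul]
  have hWk' : Y * W.conjTranspose.map conj * Y = conj k • W.conjTranspose := by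
    have := congrArg conjTranspose hWk
    simp only [conjTranspose_mul, hYh, conjTranspose_smul, RCLike.star_def] at this
    rw [← this, Matrix.mul_assoc]
    rfl
  have e : ∀ A B C : Op2, Y * (A * B * C) * Y = (Y * A * Y) * (Y * B * Y) * (Y * C * Y) := by
    intro A B C
    have e1 : ∀ Z : Op2, Y * (Y * Z) = Z := fun Z => by
      rw [← Matrix.mul_assoc, hYY, Matrix.one_mul]
    simp only [Matrix.mul_assoc, e1]
  rw [spinFlip, Matrix.map_mul, Matrix.map_mul, e, hWk, hWk', spinFlip]
  simp only [Matrix.smul_mul, Matrix.mul_smul, smul_smul]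
  rw [mul_comm, hk, one_smul]

lemma charpoly_unitary_conj {n : Type*} [Fintype n] [DecidableEq n] {W : Matrix n n ℂ}
    (hW : W ∈ unitaryGroup n ℂ) (A : Matrix n n ℂ) :
    (W * A * W.conjTranspose).charpoly = A.charpoly := by
  rw [charpoly_mul_comm, ← Matrix.mul_assoc, conjTranspose_mul_self_of_mem hW, Matrix.one_mul]

/-- The splitting of the basis into `{|00⟩, |11⟩}` and `{|01⟩, |10⟩}`. -/
def parityEquiv : Two ≃ Fin 2 ⊕ Fin 2 where
  toFun x := if x.1 = x.2 then .inl x.1 else .inr x.1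
  invFun := Sum.elim (fun i => (i, i)) (fun i => (i, i + 1))
  left_inv := by decide
  right_inv := by decide

lemma charpoly_mcMatrix_mul_spinFlip (r : ℝ) (c : ℂ) {s : ℝ} (hs : s ^ 2 = r * (1 - r)) :
    (mcMatrix r c * spinFlip (mcMatrix r c)).charpoly =
      (Polynomial.X - Polynomial.C (((s + ‖c‖) ^ 2 : ℝ) : ℂ)) *
        (Polynomial.X - Polynomial.C (((s - ‖c‖) ^ 2 : ℝ) : ℂ)) * Polynomial.X ^ 2 := by
  have hblock : reindex parityEquiv parityEquiv (mcMatrix r c * spinFlip (mcMatrix r c)) =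
      fromBlocks !![(r : ℂ) * (1 - r) + c * conj c, 2 * r * c;
        2 * (1 - r) * conj c, (r : ℂ) * (1 - r) + c * conj c] 0 0 0 := by
    -- The spin flip exchanges the two populations and keeps the coherence.
    have hsf : spinFlip (mcMatrix r c) = mcMatrix (1 - r) c := by
      ext ⟨i, j⟩ ⟨k, l⟩
      fin_cases i <;> fin_cases j <;> fin_cases k <;> fin_cases l <;>
        simp [spinFlip, mcMatrix, pauliY, Matrix.mul_apply, Fintype.sum_prod_type,
          Matrix.single_apply]
    rw [hsf]
    ext (i | i) (j | j) <;> fin_cases i <;> fin_cases j <;>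
      simp [parityEquiv, mcMatrix, Matrix.mul_apply, Fintype.sum_prod_type,
        Matrix.single_apply] <;> ring
  rw [← charpoly_reindex parityEquiv, hblock, charpoly_fromBlocks_zero₁₂, charpoly_fin_two,
    charpoly_zero]
  have htr : (((s + ‖c‖) ^ 2 : ℝ) : ℂ) + (((s - ‖c‖) ^ 2 : ℝ) : ℂ) =
      2 * ((r : ℂ) * (1 - r) + c * conj c) := by
    rw [Complex.mul_conj']
    have := congrArg (fun x : ℝ => (x : ℂ)) hs
    push_cast at this ⊢
    linear_combination 2 * this
  have hdet : (((s + ‖c‖) ^ 2 : ℝ) : ℂ) * (((s - ‖c‖) ^ 2 : ℝ) : ℂ) =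
      ((r : ℂ) * (1 - r) + c * conj c) ^ 2 - 2 * r * c * (2 * (1 - r) * conj c) := by
    have h1 := Complex.mul_conj' c
    have h2 := congrArg (fun x : ℝ => (x : ℂ)) hs
    have : ((r : ℂ) * (1 - r) + c * conj c) ^ 2 - 2 * r * c * (2 * (1 - r) * conj c) =
        ((r : ℂ) * (1 - r) - c * conj c) ^ 2 := by ring
    rw [this, h1]
    push_cast at h2 ⊢
    rw [← h2]
    ring
  congr 1
  rw [trace_fin_two_of, det_fin_two_of, ← pow_two, ← hdet, ← two_mul, ← htr]
  simp only [map_add, map_mul]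
  ring

lemma roots_charpoly_mcMatrix (r : ℝ) (c : ℂ) {s : ℝ} (hs : s ^ 2 = r * (1 - r)) :
    (mcMatrix r c * spinFlip (mcMatrix r c)).charpoly.roots =
      {(((s + ‖c‖) ^ 2 : ℝ) : ℂ), (((s - ‖c‖) ^ 2 : ℝ) : ℂ), 0, 0} := by
  have h : (mcMatrix r c * spinFlip (mcMatrix r c)).charpoly =
      (({(((s + ‖c‖) ^ 2 : ℝ) : ℂ), (((s - ‖c‖) ^ 2 : ℝ) : ℂ), 0, 0} : Multiset ℂ).map
        fun a => Polynomial.X - Polynomial.C a).prod := by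
    rw [charpoly_mcMatrix_mul_spinFlip r c hs]
    simp
    ring
  rw [h, Polynomial.roots_multiset_prod_X_sub_C]

/-- The principal minor on $|00\rangle,|11\rangle$ of a positive semidefinite matrix is nonnegative.
-/
lemma HasMCForm.norm_sq_le {ρ : Op2} (hρ : ρ.PosSemidef) {S T : Op1} {r : ℝ} {c : ℂ}
    (h : HasMCForm ρ S T r c) : ‖c‖ ^ 2 ≤ r * (1 - r) := by
  obtain ⟨hS, hT, h⟩ := h
  have hW : S ⊗ₖ T ∈ unitaryGroup Two ℂ := kronecker_mem_unitary hS hT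
  have hm : (mcMatrix r c).PosSemidef := by
    rw [← conj_eq_of_eq_conj hW h]
    exact hρ.conjTranspose_mul_mul_same _
  have hdet := (hm.submatrix (fun i : Fin 2 => (i, i))).det_nonneg
  have e : ((mcMatrix r c).submatrix (fun i : Fin 2 => (i, i)) (fun i : Fin 2 => (i, i))).det =
      ((r * (1 - r) - ‖c‖ ^ 2 : ℝ) : ℂ) := by
    rw [det_fin_two]
    simp [mcMatrix, Complex.mul_conj']
  rw [e, Complex.zero_le_real] at hdet
  linarith

lemma HasMCForm.concurrence_eq {ρ : Op2} (hρ : ρ.PosSemidef) {S T : Op1} {r : ℝ} {c : ℂ}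
    (h : HasMCForm ρ S T r c) : concurrence ρ = 2 * ‖c‖ := by
  have hle := h.norm_sq_le hρ
  obtain ⟨hS, hT, rfl⟩ := h
  have hW : S ⊗ₖ T ∈ unitaryGroup Two ℂ := kronecker_mem_unitary hS hT
  set s := √(r * (1 - r)) with hs
  have hs2 : s ^ 2 = r * (1 - r) := Real.sq_sqrt ((sq_nonneg _).trans hle)
  -- Positivity of $\rho$ enters here: it makes the square root of $(s-|c|)^2$ equal to $s-|c|$, so
  -- that $s$ cancels from the concurrence.
  have hcs : ‖c‖ ≤ s := Real.le_sqrt_of_sq_le hle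
  have hc := norm_nonneg c
  have hspec : woottersSpectrum (S ⊗ₖ T * mcMatrix r c * (S ⊗ₖ T).conjTranspose) =
      [s + ‖c‖, s - ‖c‖, 0, 0] := by
    rw [woottersSpectrum, spinFlip_conj hS hT, conj_mul_conj hW, charpoly_unitary_conj hW,
      roots_charpoly_mcMatrix r c hs2]
    have : (({(((s + ‖c‖) ^ 2 : ℝ) : ℂ), (((s - ‖c‖) ^ 2 : ℝ) : ℂ), 0, 0} : Multiset ℂ).map
        fun z => √z.re) = ([s + ‖c‖, s - ‖c‖, 0, 0] : List ℝ) := by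
      simp only [Multiset.insert_eq_cons, Multiset.map_cons, Multiset.map_singleton,
        Complex.ofReal_re, Complex.zero_re, Real.sqrt_zero,
        Real.sqrt_sq (add_nonneg (hc.trans hcs) hc), Real.sqrt_sq (sub_nonneg.mpr hcs)]
      rfl
    rw [this, Multiset.coe_sort]
    apply List.mergeSort_eq_self
    simp [hcs]
    constructor <;> linarith
  rw [concurrence, hspec]
  simp
  linarith [max_eq_right (show (0 : ℝ) ≤ 2 * ‖c‖ by positivity)]

/-! ### The maximal trace distance and win probability -/

lemma Admissible.mul_eq {ρ : Op2} (hρ : IsDensity ρ) {U V : Op1} (h : Admissible ρ U V) :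
    onA U * ρ = onB V * ρ := (neverDisturbs_iff_mul_eq hρ h.1 h.2.1).mp h.2.2

lemma usable_iff_stronglyAnonymous {ρ : Op2} (hρ : IsDensity ρ) :
    Usable ρ ↔ StronglyAnonymous ρ := by
  constructor
  · rintro ⟨U, V, h, hU, hV⟩
    exact ⟨U, h.1, V, h.2.1, hU, hV, h.mul_eq hρ⟩
  · rintro ⟨U, hU, V, hV, hU', hV', h⟩
    exact ⟨U, V, ⟨hU, hV, (neverDisturbs_iff_mul_eq hρ hU hV).mpr h⟩, hU', hV'⟩

lemma stronglyAnonymous_iff_maximallyCorrelated {ρ : Op2} (hρ : IsDensity ρ) :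
    StronglyAnonymous ρ ↔ MaximallyCorrelated ρ := by
  constructor
  · rintro ⟨U, hU, V, hV, hU', hV', h⟩
    obtain ⟨S, T, r, c, hmc, -⟩ := exists_hasMCForm hρ hU hV hU' hV' h
    exact ⟨S, T, r, c, hmc⟩
  · rintro ⟨S, T, r, c, h⟩
    exact h.stronglyAnonymous

lemma Admissible.traceDist_eq_zero {ρ : Op2} (hρ : IsDensity ρ) {U V : Op1}
    (h : Admissible ρ U V) (hUV : ¬ (NonScalar U ∧ NonScalar V)) :
    traceDist (conjA U ρ) ρ = 0 := by
  have hc : conjA U ρ = ρ := by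
    rcases not_and_or.mp hUV with hs | hs <;> obtain ⟨z, hz⟩ := not_forall_not.mp hs
    · exact conjA_eq_of_left_scalar h.1 hz
    · exact conjA_eq_of_right_scalar hρ.1.1 h.2.1 (h.mul_eq hρ) hz
  rw [hc, traceDist_self]

lemma Admissible.traceDist_le {ρ : Op2} (hρ : IsDensity ρ) {S T : Op1} {r : ℝ} {c : ℂ}
    (hmc : HasMCForm ρ S T r c) {U V : Op1} (h : Admissible ρ U V) :
    traceDist (conjA U ρ) ρ ≤ 2 * ‖c‖ := by
  by_cases hUV : NonScalar U ∧ NonScalar V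
  -- The bases adapted to $U,V$ may differ from $S,T$; comparing concurrences gives $|c'|=|c|$.
  · obtain ⟨S', T', r', c', hmc', ⟨d, hd⟩, -⟩ :=
      exists_hasMCForm hρ h.1 h.2.1 hUV.1 hUV.2 (h.mul_eq hρ)
    have hn : ∀ i, ‖d i‖ = 1 := fun i => by
      have := congrArg norm (eigenvalue_mul_conj h.1 hmc'.1 hd i)
      rw [norm_mul, RCLike.norm_conj, norm_one] at this
      nlinarith [norm_nonneg (d i)]
    rw [traceDist_conjA hmc' h.1 hd, ← hmc.concurrence_eq hρ.1, hmc'.concurrence_eq hρ.1]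
    refine mul_le_mul_of_nonneg_right ((norm_sub_le _ _).trans ?_) (norm_nonneg _)
    rw [norm_mul, RCLike.norm_conj, hn, hn, norm_one]
    norm_num
  · rw [h.traceDist_eq_zero hρ hUV]
    positivity

lemma HasMCForm.admissible_signFlip {ρ : Op2} (hρ : IsDensity ρ) {S T : Op1} {r : ℝ} {c : ℂ}
    (h : HasMCForm ρ S T r c) : Admissible ρ (signFlip S) (signFlip T) :=
  ⟨signFlip_mem h.1, signFlip_mem h.2.1, (neverDisturbs_iff_mul_eq hρ (signFlip_mem h.1)
    (signFlip_mem h.2.1)).mpr (onA_signFlip_mul_eq h)⟩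

lemma HasMCForm.isGreatest_traceDist {ρ : Op2} (hρ : IsDensity ρ) {S T : Op1} {r : ℝ} {c : ℂ}
    (h : HasMCForm ρ S T r c) :
    IsGreatest {t : ℝ | ∃ U V, Admissible ρ U V ∧ t = traceDist (conjA U ρ) ρ} (2 * ‖c‖) := by
  constructor
  -- Eigenvalues $1,-1$ give $|d_0\overline{d_1}-1|=2$, the largest value for two phases.
  · refine ⟨signFlip S, signFlip T, h.admissible_signFlip hρ, ?_⟩
    rw [traceDist_conjA h (signFlip_mem h.1) (conj_eq_of_eq_conj h.1 rfl)]
    congr 1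
    simp
    norm_num
  · rintro t ⟨U, V, hUV, rfl⟩
    exact hUV.traceDist_le hρ h

/-- Optimising the measurement first reduces the win probability to the trace distance. -/
lemma isGreatest_pnp2WinProbs {ρ : Op2} (hρ : IsDensity ρ) {t : ℝ}
    (h : IsGreatest {t : ℝ | ∃ U V, Admissible ρ U V ∧ t = traceDist (conjA U ρ) ρ} t) :
    IsGreatest (pnp2WinProbs ρ) (1 / 2 * (1 + t)) := by
  constructor
  · obtain ⟨U, V, hUV, rfl⟩ := h.1
    obtain ⟨M, hM, hp⟩ := (isGreatest_pnpWinProb hρ hUV).1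
    exact ⟨U, V, M, hUV, hM, hp⟩
  · rintro p ⟨U, V, M, hUV, hM, rfl⟩
    have h1 := (isGreatest_pnpWinProb hρ hUV).2 ⟨M, hM, rfl⟩
    have h2 := h.2 ⟨U, V, hUV, rfl⟩
    linarith

lemma isGreatest_traceDist_of_not_stronglyAnonymous {ρ : Op2} (hρ : IsDensity ρ)
    (h : ¬ StronglyAnonymous ρ) :
    IsGreatest {t : ℝ | ∃ U V, Admissible ρ U V ∧ t = traceDist (conjA U ρ) ρ} 0 := by
  have hz : ∀ U V, Admissible ρ U V → traceDist (conjA U ρ) ρ = 0 := fun U V hUV =>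
    hUV.traceDist_eq_zero hρ fun hn =>
      h ((usable_iff_stronglyAnonymous hρ).mp ⟨U, V, hUV, hn.1, hn.2⟩)
  have h1 : Admissible ρ 1 1 := ⟨one_mem _, one_mem _,
    (neverDisturbs_iff_mul_eq hρ (one_mem _) (one_mem _)).mpr rfl⟩
  exact ⟨⟨1, 1, h1, (hz _ _ h1).symm⟩, by
    rintro t ⟨U, V, hUV, rfl⟩
    exact (hz U V hUV).le⟩

end DelocalisedGame

theorem mainTheorem11 (ρ : DelocalisedGame.Op2) (hρ : DelocalisedGame.IsDensity ρ) :
    -- the no-disturbance condition, in its equivalent forms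
    (∀ U ∈ Matrix.unitaryGroup (Fin 2) ℂ, ∀ V ∈ Matrix.unitaryGroup (Fin 2) ℂ,
      (DelocalisedGame.NeverDisturbs ρ U V ↔
        (DelocalisedGame.onA U * ρ * (DelocalisedGame.onB V).conjTranspose).trace.re = 1) ∧
      (DelocalisedGame.NeverDisturbs ρ U V ↔
        DelocalisedGame.onA U * ρ = DelocalisedGame.onB V * ρ)) ∧
    -- the win probability for given admissible unitaries and the best measurement
    (∀ U V, DelocalisedGame.Admissible ρ U V →
      IsGreatest {p : ℝ | ∃ M, DelocalisedGame.IsPOVM M ∧ p = DelocalisedGame.pnpWinProb ρ U V M}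
        (1 / 2 * (1 + DelocalisedGame.traceDist (DelocalisedGame.conjA U ρ) ρ))) ∧
    -- the usable states are the strongly anonymous ones, which are the maximally correlated ones
    (DelocalisedGame.Usable ρ ↔ DelocalisedGame.StronglyAnonymous ρ) ∧
    (DelocalisedGame.StronglyAnonymous ρ ↔ DelocalisedGame.MaximallyCorrelated ρ) ∧
    -- the maximally correlated form is taken in eigenbases of the local unitaries
    (∀ U V, DelocalisedGame.Admissible ρ U V →
      DelocalisedGame.NonScalar U → DelocalisedGame.NonScalar V →
      ∃ S T r c, DelocalisedGame.HasMCForm ρ S T r c ∧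
        (S.conjTranspose * U * S).IsDiag ∧ (T.conjTranspose * V * T).IsDiag) ∧
    -- the maximal trace distance is twice the coherence, and equals the concurrence
    (∀ S T r c, DelocalisedGame.HasMCForm ρ S T r c →
      IsGreatest {t : ℝ | ∃ U V, DelocalisedGame.Admissible ρ U V ∧
          t = DelocalisedGame.traceDist (DelocalisedGame.conjA U ρ) ρ} (2 * ‖c‖) ∧
      2 * ‖c‖ = DelocalisedGame.concurrence ρ) ∧
    -- the maximum win probability, for strongly anonymous states and for all other states
    (DelocalisedGame.StronglyAnonymous ρ →
      IsGreatest (DelocalisedGame.pnp2WinProbs ρ)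
        (1 / 2 * (1 + DelocalisedGame.concurrence ρ))) ∧
    (¬ DelocalisedGame.StronglyAnonymous ρ →
      IsGreatest (DelocalisedGame.pnp2WinProbs ρ) (1 / 2)) := by
  open DelocalisedGame in
  refine ⟨fun U hU V hV => ⟨neverDisturbs_iff_trace hρ hU hV, neverDisturbs_iff_mul_eq hρ hU hV⟩,
    fun U V h => isGreatest_pnpWinProb hρ h, usable_iff_stronglyAnonymous hρ,
    stronglyAnonymous_iff_maximallyCorrelated hρ, ?_,
    fun S T r c h => ⟨h.isGreatest_traceDist hρ, (h.concurrence_eq hρ.1).symm⟩, ?_, ?_⟩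
  · intro U V h hU hV
    obtain ⟨S, T, r, c, hmc, ⟨d, hd⟩, e, he⟩ :=
      DelocalisedGame.exists_hasMCForm hρ h.1 h.2.1 hU hV (h.mul_eq hρ)
    exact ⟨S, T, r, c, hmc, hd ▸ Matrix.isDiag_diagonal d, he ▸ Matrix.isDiag_diagonal e⟩
  · intro h
    obtain ⟨S, T, r, c, hmc⟩ :=
      (DelocalisedGame.stronglyAnonymous_iff_maximallyCorrelated hρ).mp h
    rw [hmc.concurrence_eq hρ.1]
    exact DelocalisedGame.isGreatest_pnp2WinProbs hρ (hmc.isGreatest_traceDist hρ)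
  · intro h
    simpa using DelocalisedGame.isGreatest_pnp2WinProbs hρ
      (DelocalisedGame.isGreatest_traceDist_of_not_stronglyAnonymous hρ h)
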